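/- **Setting.** Let $\lambda>0$, $T>0$, $r\in\mathbb R$, $K\ge 0$, $S_0>0$, $\sigma_0^2>0$ and $\rho\in\mathbb R$ be constants, and let $Z=(Z_t)_{t\ge0}$ be a subordinator (nondecreasing Lévy process) on a probability space with measure $\mathbb Q$. Let $\kappa(\theta)=\ln E[e^{\theta Z_1}]\in(-\infty,\infty]$ and $\hat\kappa=\sup\{\theta\in\mathbb R:\kappa(\theta)<\infty\}$, and assume $\hat\kappa>0$ and $\rho<\hat\kappa$. Let $\sigma^2$ solve $d\sigma_t^2=-\lambda\sigma_t^2\,dt+dZ_{\lambda t}$ on $[0,T]$ with initial value $\sigma_0^2$, and put $$I_T=\int_0^T\sigma_s^2\,ds,\qquad P_T=e^{\rho Z_{\lambda T}-\lambda T\kappa(\rho)},\qquad \alpha_{0,T}=\tfrac1\lambda\left(1-e^{-\lambda T}\right).$$ With $\Phi$ the standard normal distribution function, let $$BS_{Put}(x,y)=Ke^{-rT}\Phi(-d_-)-x\Phi(-d_+),\qquad d_\pm=\tfrac1{\sqrt y}\left(\ln\tfrac xK+rT\pm\tfrac12y\right)$$ for $x,y>0$ (with $BS_{Put}=0$ if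 $K=0$), and let $\Pi_N$ be the $N$-th order approximation of the put price with strike $K$ and expiration date $T$, $$\Pi_N=BS_{Put}(S_0,E[I_T])+\sum_{n=2}^N\frac1{n!}\sum_{k=0}^n\binom nk S_0^{n-k}E\left[(P_T-1)^{n-k}(I_T-E[I_T])^k\right]\frac{\partial^nBS_{Put}}{\partial x^{n-k}\partial y^k}(S_0,E[I_T]).$$ **Corollary (second order approximation).** The derivatives $\kappa'(0)$, $\kappa''(0)$ and $\kappa'(\rho)$ exist, $\kappa$ being twice continuously differentiable near $0$ and finite and differentiable at $\rho$; moreover $E[I_T]>0$ and $BS_{Put}$ is twice continuously differentiable near $(S_0,E[I_T])$. The random variables $I_T$, $(I_T-E[I_T])^2$ and $(P_T-1)(I_T-E[I_T])$ are integrable, and $$E[I_T]=\alpha_{0,T}\left(\sigma_0^2-\kappa'(0)\right)+\kappa'(0)T,$$ $$E\left[(I_T-E[I_T])^2\right]=\frac{\kappa''(0)}{\lambda^2}\left(\lambda T-\tfrac32+2e^{-\lambda T}-\tfrac12e^{-2\lambda T}\right),$$ $$E\left[(P_T-1)(I_T-E[I_T])\right]=\left(\kappa'(\rho)-\kappa'(0)\right)\left(T-\alpha_{0,T}\right).$$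 If in addition $\kappa(2\rho)<\infty$, then $(P_T-1)^2$ is integrable, $$E\left[(P_T-1)^2\right]=e^{\lambda T(\kappa(2\rho)-2\kappa(\rho))}-1,$$ and $$\begin{aligned}\Pi_2={}&BS_{Put}(S_0,E[I_T])+\frac12\frac{\partial^2BS_{Put}}{\partial x^2}(S_0,E[I_T])\,S_0^2\,E\left[(P_T-1)^2\right]\\&+\frac12\frac{\partial^2BS_{Put}}{\partial y^2}(S_0,E[I_T])\,E\left[(I_T-E[I_T])^2\right]\\&+\frac{\partial^2BS_{Put}}{\partial x\,\partial y}(S_0,E[I_T])\,S_0\,E\left[(P_T-1)(I_T-E[I_T])\right].\end{aligned}$$ -/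

import Mathlib

open MeasureTheory ProbabilityTheory Set
open scoped NNReal

noncomputable section

namespace BNS

/-- `Z` is a subordinator under `Q`: a real Lévy process (started at `0`, with independent and
stationary increments and càdlàg paths) whose paths are nondecreasing. Left limits of the paths
exist automatically by monotonicity. -/
structure IsSubordinator {Ω : Type*} [MeasurableSpace Ω] (Z : ℝ≥0 → Ω → ℝ) (Q : Measure Ω) :
    Prop where
  aemeasurable : ∀ t, AEMeasurable (Z t) Q
  zero : ∀ᵐ ω ∂Q, Z 0 ω = 0
  indep_increments : HasIndepIncrements Z Q
  stationary_increments : ∀ s h : ℝ≥0, IdentDistrib (fun ω => Z (s + h) ω - Z s ω) (Z h) Q Q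
  monotone_paths : ∀ᵐ ω ∂Q, Monotone fun t => Z t ω
  right_continuous_paths : ∀ᵐ ω ∂Q, ∀ t, ContinuousWithinAt (fun u => Z u ω) (Ici t) t

/-- The process `t ↦ Z_{λ t}` for real `t ≥ 0` (and `lam = λ ≥ 0`). -/
def timeChanged {Ω : Type*} (Z : ℝ≥0 → Ω → ℝ) (lam t : ℝ) (ω : Ω) : ℝ :=
  Z (lam * t).toNNReal ω

/-- `V` (the squared volatility `σ²`) solves `dV_t = -λ V_t dt + dZ_{λ t}`, `V_0 = v₀`,
on `[0, T]`, written in integrated form. -/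
def IsVariance {Ω : Type*} [MeasurableSpace Ω] (V : ℝ → Ω → ℝ) (Z : ℝ≥0 → Ω → ℝ)
    (Q : Measure Ω) (lam v₀ T : ℝ) : Prop :=
  ∀ᵐ ω ∂Q, IntervalIntegrable (fun s => V s ω) volume 0 T ∧
    ∀ t ∈ Icc 0 T,
      V t ω = v₀ - lam * (∫ s in (0 : ℝ)..t, V s ω) + (timeChanged Z lam t ω - Z 0 ω)

/-- The cumulant generating function `κ(θ) = ln E[exp(θ Z₁)]`; it is finite exactly on
`integrableExpSet (Z 1) Q`, and only its values there are meaningful. -/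
def kappa {Ω : Type*} [MeasurableSpace Ω] (Z : ℝ≥0 → Ω → ℝ) (Q : Measure Ω) (θ : ℝ) : ℝ :=
  cgf (Z 1) Q θ

/-- `κ(θ) < ∞`, that is, `E[exp(θ Z₁)] < ∞`. -/
def KappaFinite {Ω : Type*} [MeasurableSpace Ω] (Z : ℝ≥0 → Ω → ℝ) (Q : Measure Ω) (θ : ℝ) :
    Prop :=
  θ ∈ integrableExpSet (Z 1) Q

/-- `κ̂ = sup {θ : κ(θ) < ∞}`, possibly `+∞`. -/
def kappaHat {Ω : Type*} [MeasurableSpace Ω] (Z : ℝ≥0 → Ω → ℝ) (Q : Measure Ω) : EReal :=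
  sSup ((fun θ : ℝ => (θ : EReal)) '' {θ : ℝ | KappaFinite Z Q θ})

/-- `α_{s,t} = (1 - exp(-λ (t - s))) / λ`. -/
def alpha (lam s t : ℝ) : ℝ := 1 / lam * (1 - Real.exp (-lam * (t - s)))

/-- The integrated variance `I_t = ∫₀ᵗ σ_s² ds`. -/
def integratedVariance {Ω : Type*} (V : ℝ → Ω → ℝ) (t : ℝ) (ω : Ω) : ℝ :=
  ∫ s in (0 : ℝ)..t, V s ω

/-- `P_t = exp(ρ Z_{λ t} - λ t κ(ρ))`. -/
def priceFactor {Ω : Type*} [MeasurableSpace Ω] (Z : ℝ≥0 → Ω → ℝ) (Q : Measure Ω)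
    (lam ρ t : ℝ) (ω : Ω) : ℝ :=
  Real.exp (ρ * timeChanged Z lam t ω - lam * t * kappa Z Q ρ)

/-- The standard normal cumulative distribution function `Φ`. -/
def stdNormalCDF (z : ℝ) : ℝ := cdf (gaussianReal 0 1) z

/-- `d_+(x, y)`. -/
def dPlus (r K T x y : ℝ) : ℝ :=
  1 / Real.sqrt y * (Real.log (x / K) + r * T + 1 / 2 * y)

/-- `d_-(x, y)`. -/
def dMinus (r K T x y : ℝ) : ℝ :=
  1 / Real.sqrt y * (Real.log (x / K) + r * T - 1 / 2 * y)

/-- The Black-Scholes put price `BS_Put(x, y) = K e^{-rT} Φ(-d_-) - x Φ(-d_+)`, where `y` is the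
total variance. For strike `K = 0` one has `d_± = +∞` and the price is `0`. -/
def bsPut (r K T x y : ℝ) : ℝ :=
  if K = 0 then 0
  else K * Real.exp (-(r * T)) * stdNormalCDF (-dMinus r K T x y)
    - x * stdNormalCDF (-dPlus r K T x y)

/-- The partial derivative `∂^{a+b} f / ∂x^a ∂y^b` at `(x, y)`. -/
def partialDeriv (a b : ℕ) (f : ℝ → ℝ → ℝ) (x y : ℝ) : ℝ :=
  iteratedDeriv a (fun x' => iteratedDeriv b (fun y' => f x' y') y) x

/-- The `N`-th order Taylor approximation `Π_N` of the put price, for initial price `S₀`, in terms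
of the random variables `P = P_T` and `I = I_T`. -/
def putApprox {Ω : Type*} [MeasurableSpace Ω] (Q : Measure Ω) (r K T S₀ : ℝ) (P I : Ω → ℝ)
    (N : ℕ) : ℝ :=
  bsPut r K T S₀ (∫ ω, I ω ∂Q) +
    ∑ n ∈ Finset.Icc 2 N, 1 / (n.factorial : ℝ) *
      ∑ k ∈ Finset.range (n + 1), (n.choose k : ℝ) * S₀ ^ (n - k) *
        (∫ ω, (P ω - 1) ^ (n - k) * (I ω - ∫ ω', I ω' ∂Q) ^ k ∂Q) *
        partialDeriv (n - k) k (bsPut r K T) S₀ (∫ ω, I ω ∂Q)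

end BNS

end

/-! Variation of constants (`integral_eq_of_linear_equation`) rewrites the integrated variance
pathwise as `α v₀ + ∫₀ᵀ exp(-λ(T-s)) Z_{λs} ds`. By Fubini (`integral_mul_weighted`), integrating it
against a random variable `X` only requires `E[X Z_{λs}]` for each `s`, weighted by the exponential
kernel. Taking `X = 1` gives the mean, `X = P - 1` the cross moment, and `X = I - m` the variance;
the last needs a preliminary application with `X` the centred `Z_{λs}`.

The expectations `E[X Z_{λs}]` come from the cumulant function. Independent stationary increments
and monotone paths force the cumulant function of `Z_t` to be `t κ` (`cgf_eq`). Its derivatives at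
`0` give mean and variance, its derivative at `ρ` the mean under exponential tilting, and
independence of increments extends these to two times (`integral_sub_mul`, `integral_exp_mul`).
Elementary integrals finish the moment formulas, and the approximation formula is the Taylor sum
with only `n = 2` present. -/

namespace BNS

/-- A monotone additive function on `ℝ≥0` is linear. -/
theorem eq_mul_of_monotone_of_add {f : ℝ≥0 → ℝ} (hf : Monotone f)
    (hadd : ∀ s t, f (s + t) = f s + f t) (t : ℝ≥0) : f t = t * f 1 := by
  have h0 : f 0 = 0 := by simpa using hadd 0 0
  have hnsmul : ∀ (n : ℕ) (s : ℝ≥0), f (n * s) = n * f s := by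
    intro n s
    induction n with
    | zero => simp [h0]
    | succ n ih => push_cast; rw [add_mul, hadd, ih]; simp; ring
  have hone : 0 ≤ f 1 := h0 ▸ hf zero_le_one
  have hnat : ∀ n : ℕ, f n = n * f 1 := fun n => by simpa using hnsmul n 1
  -- Both `f (n t)` and `n t f 1` lie between `k f 1` and `(k + 1) f 1` with `k = ⌊n t⌋`, so they
  -- differ by at most `f 1`, uniformly in `n`.
  have hbound : ∀ n : ℕ, n * |f t - t * f 1| ≤ f 1 := by
    intro n
    have hlo : f ⌊(n : ℝ≥0) * t⌋₊ ≤ f (n * t) := hf (Nat.floor_le zero_le)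
    have hhi : f (n * t) ≤ f ((⌊(n : ℝ≥0) * t⌋₊ + 1 : ℕ)) := by
      refine hf ?_
      push_cast
      exact (Nat.lt_floor_add_one _).le
    have hlo' : ((⌊(n : ℝ≥0) * t⌋₊ : ℝ≥0) : ℝ) ≤ ((n * t : ℝ≥0) : ℝ) :=
      NNReal.coe_le_coe.2 (Nat.floor_le zero_le)
    have hhi' : ((n * t : ℝ≥0) : ℝ) ≤ ((⌊(n : ℝ≥0) * t⌋₊ + 1 : ℝ≥0) : ℝ) :=
      NNReal.coe_le_coe.2 (Nat.lt_floor_add_one _).le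
    rw [hnat, hnsmul] at hlo hhi
    push_cast at hlo hhi hlo' hhi'
    rw [← abs_of_nonneg (Nat.cast_nonneg (α := ℝ) n), ← abs_mul, abs_le]
    constructor <;> nlinarith
  by_contra hne
  have hpos : 0 < |f t - t * f 1| := abs_pos.2 (sub_ne_zero.2 hne)
  obtain ⟨n, hn⟩ := exists_nat_gt (f 1 / |f t - t * f 1|)
  rw [div_lt_iff₀ hpos] at hn
  exact absurd (hbound n) (not_le.2 hn)

/-- Since `X ≥ 0`, `exp(uX)` is at most `1` for `u ≤ 0` and at most `exp(vY)` for `u ≥ 0`, hence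
always at most their sum. -/
theorem integrable_exp_mul_of_le {Ω : Type*} [MeasurableSpace Ω] {Q : Measure Ω}
    [IsFiniteMeasure Q] {X Y : Ω → ℝ} {u v : ℝ} (hX : AEMeasurable X Q) (h0 : ∀ᵐ ω ∂Q, 0 ≤ X ω)
    (hXY : ∀ᵐ ω ∂Q, X ω ≤ Y ω) (huv : u ≤ v) (hY : v ∈ integrableExpSet Y Q) :
    u ∈ integrableExpSet X Q := by
  have hmeas : AEMeasurable (fun ω => Real.exp (u * X ω)) Q := (hX.const_mul u).exp
  refine Integrable.mono' ((integrable_const (1 : ℝ)).add hY) hmeas.aestronglyMeasurable ?_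
  filter_upwards [h0, hXY] with ω h1 h2
  rw [Real.norm_of_nonneg (Real.exp_pos _).le]
  simp only [Pi.add_apply]
  rcases le_total u 0 with hu | hu
  · have := Real.exp_le_one_iff.2 (mul_nonpos_of_nonpos_of_nonneg hu h1)
    have := Real.exp_pos (v * Y ω)
    linarith
  · have : u * X ω ≤ v * Y ω := mul_le_mul huv h2 h1 (hu.trans huv)
    have := Real.exp_le_exp.2 this
    linarith

/-! ### Exponential and polynomial moments of a subordinator -/

namespace IsSubordinator

variable {Ω : Type*} [MeasurableSpace Ω] {Q : Measure Ω} {Z : ℝ≥0 → Ω → ℝ}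

theorem ae_nonneg (hZ : IsSubordinator Z Q) : ∀ᵐ ω ∂Q, ∀ t, 0 ≤ Z t ω := by
  filter_upwards [hZ.zero, hZ.monotone_paths] with ω h0 hm t
  exact h0 ▸ hm zero_le

theorem ae_le (hZ : IsSubordinator Z Q) {s t : ℝ≥0} (hst : s ≤ t) : ∀ᵐ ω ∂Q, Z s ω ≤ Z t ω := by
  filter_upwards [hZ.monotone_paths] with ω hm using hm hst

theorem indepFun_add (hZ : IsSubordinator Z Q) (s h : ℝ≥0) :
    IndepFun (Z s) (Z (s + h) - Z s) Q :=
  hZ.indep_increments.indepFun_eval_sub zero_le le_self_add hZ.zero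

theorem mgf_sub (hZ : IsSubordinator Z Q) (s h : ℝ≥0) (θ : ℝ) :
    mgf (Z (s + h) - Z s) Q θ = mgf (Z h) Q θ :=
  ((hZ.stationary_increments s h).comp (u := fun x => Real.exp (θ * x)) (by fun_prop)).integral_eq

theorem mgf_add (hZ : IsSubordinator Z Q) (s h : ℝ≥0) (θ : ℝ) :
    mgf (Z (s + h)) Q θ = mgf (Z s) Q θ * mgf (Z h) Q θ := by
  have := (hZ.indepFun_add s h).mgf_add' (t := θ) (hZ.aemeasurable s).aestronglyMeasurable
    ((hZ.aemeasurable _).sub (hZ.aemeasurable s)).aestronglyMeasurable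
  rw [add_sub_cancel] at this
  rw [this, hZ.mgf_sub]

variable [IsProbabilityMeasure Q]

theorem mem_integrableExpSet_nat (hZ : IsSubordinator Z Q) {θ : ℝ}
    (hθ : θ ∈ integrableExpSet (Z 1) Q) (n : ℕ) : θ ∈ integrableExpSet (Z n) Q := by
  induction n with
  | zero =>
    refine (integrable_const (1 : ℝ)).congr ?_
    filter_upwards [hZ.zero] with ω h
    simp [h]
  | succ n ih =>
    have hinc : Integrable (fun ω => Real.exp (θ * (Z (n + 1) - Z n) ω)) Q :=
      ((hZ.stationary_increments n 1).comp
        (u := fun x => Real.exp (θ * x)) (by fun_prop)).integrable_iff.2 hθ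
    have := (hZ.indepFun_add n 1).integrable_exp_mul_add ih hinc
    simpa [integrableExpSet] using this

/-- Integer times follow by adding independent increments; any other time is dominated by its
ceiling. -/
theorem mem_integrableExpSet (hZ : IsSubordinator Z Q) {θ : ℝ}
    (hθ : θ ∈ integrableExpSet (Z 1) Q) (t : ℝ≥0) : θ ∈ integrableExpSet (Z t) Q := by
  refine integrable_exp_mul_of_le (hZ.aemeasurable t) ?_ (hZ.ae_le (Nat.le_ceil t)) le_rfl
    (hZ.mem_integrableExpSet_nat hθ _)
  filter_upwards [hZ.ae_nonneg] with ω h using h t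

/-- Additivity in `t` comes from the increments. Monotone paths make the cumulant monotone in `t`,
increasing or decreasing according to the sign of `θ`, so Cauchy's equation is solved without any
continuity. -/
theorem cgf_eq (hZ : IsSubordinator Z Q) {θ : ℝ} (hθ : θ ∈ integrableExpSet (Z 1) Q) (t : ℝ≥0) :
    cgf (Z t) Q θ = t * kappa Z Q θ := by
  have hpos : ∀ t, 0 < mgf (Z t) Q θ := fun t => mgf_pos (hZ.mem_integrableExpSet hθ t)
  have hadd : ∀ s t, cgf (Z (s + t)) Q θ = cgf (Z s) Q θ + cgf (Z t) Q θ := by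
    intro s t
    rw [cgf, hZ.mgf_add, Real.log_mul (hpos s).ne' (hpos t).ne', cgf, cgf]
  rcases le_total 0 θ with h | h
  · refine eq_mul_of_monotone_of_add (f := fun t => cgf (Z t) Q θ) (fun s t hst => ?_) hadd t
    refine Real.log_le_log (hpos s) (integral_mono_ae (hZ.mem_integrableExpSet hθ s)
      (hZ.mem_integrableExpSet hθ t) ?_)
    filter_upwards [hZ.ae_le hst] with ω hω
    exact Real.exp_le_exp.2 (mul_le_mul_of_nonneg_left hω h)
  · have := eq_mul_of_monotone_of_add (f := fun t => -cgf (Z t) Q θ) (fun s t hst => ?_)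
      (fun s t => by simp only [hadd]; ring) t
    · simp only [kappa]; linarith
    refine neg_le_neg (Real.log_le_log (hpos t) (integral_mono_ae (hZ.mem_integrableExpSet hθ t)
      (hZ.mem_integrableExpSet hθ s) ?_))
    filter_upwards [hZ.ae_le hst] with ω hω
    exact Real.exp_le_exp.2 (mul_le_mul_of_nonpos_left hω h)

theorem mgf_eq (hZ : IsSubordinator Z Q) {θ : ℝ} (hθ : θ ∈ integrableExpSet (Z 1) Q) (t : ℝ≥0) :
    mgf (Z t) Q θ = Real.exp (t * kappa Z Q θ) := by
  rw [← hZ.cgf_eq hθ, exp_cgf (hZ.mem_integrableExpSet hθ t)]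

/-- Nonnegativity of `Z` makes the set of finite exponential moments downward closed, so every point
below its supremum is interior. -/
theorem mem_interior_of_lt_kappaHat (hZ : IsSubordinator Z Q) {θ : ℝ}
    (hθ : (θ : EReal) < kappaHat Z Q) (t : ℝ≥0) : θ ∈ interior (integrableExpSet (Z t) Q) := by
  obtain ⟨_, ⟨v, hv, rfl⟩, hlt⟩ := lt_sSup_iff.1 hθ
  refine mem_interior.2 ⟨Iio v, fun u hu => ?_, isOpen_Iio, EReal.coe_lt_coe_iff.1 hlt⟩
  refine hZ.mem_integrableExpSet (integrable_exp_mul_of_le (hZ.aemeasurable 1) ?_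
    (Filter.Eventually.of_forall fun _ => le_rfl) (le_of_lt hu) hv) t
  filter_upwards [hZ.ae_nonneg] with ω h using h 1

theorem cgf_eventuallyEq (hZ : IsSubordinator Z Q) {θ : ℝ}
    (hθ : (θ : EReal) < kappaHat Z Q) (t : ℝ≥0) :
    cgf (Z t) Q =ᶠ[nhds θ] fun u => t * kappa Z Q u := by
  filter_upwards [mem_interior_iff_mem_nhds.1 (hZ.mem_interior_of_lt_kappaHat hθ 1)] with u hu
  exact hZ.cgf_eq hu t

theorem analyticAt_kappa (hZ : IsSubordinator Z Q) {θ : ℝ} (hθ : (θ : EReal) < kappaHat Z Q) :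
    AnalyticAt ℝ (kappa Z Q) θ :=
  analyticAt_cgf (hZ.mem_interior_of_lt_kappaHat hθ 1)

theorem integral_mul_exp (hZ : IsSubordinator Z Q) {θ : ℝ} (hθ : (θ : EReal) < kappaHat Z Q)
    (t : ℝ≥0) : ∫ ω, Z t ω * Real.exp (θ * Z t ω) ∂Q =
      t * deriv (kappa Z Q) θ * Real.exp (t * kappa Z Q θ) := by
  have h := deriv_cgf (hZ.mem_interior_of_lt_kappaHat hθ t)
  have hmem := interior_subset (hZ.mem_interior_of_lt_kappaHat hθ 1)
  rw [(hZ.cgf_eventuallyEq hθ t).deriv_eq, deriv_const_mul_field, hZ.mgf_eq hmem,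
    eq_div_iff (Real.exp_pos _).ne'] at h
  exact h.symm

theorem memLp (hZ : IsSubordinator Z Q) (hκ : 0 < kappaHat Z Q) (t : ℝ≥0) (p : ℝ≥0) :
    MemLp (Z t) p Q :=
  memLp_of_mem_interior_integrableExpSet (hZ.mem_interior_of_lt_kappaHat (θ := 0) hκ t) p

theorem integrable (hZ : IsSubordinator Z Q) (hκ : 0 < kappaHat Z Q) (t : ℝ≥0) :
    Integrable (Z t) Q :=
  integrable_of_mem_interior_integrableExpSet (hZ.mem_interior_of_lt_kappaHat (θ := 0) hκ t)

theorem integral_eq (hZ : IsSubordinator Z Q) (hκ : 0 < kappaHat Z Q) (t : ℝ≥0) :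
    ∫ ω, Z t ω ∂Q = t * deriv (kappa Z Q) 0 := by
  have := hZ.integral_mul_exp (θ := 0) hκ t
  simpa [kappa] using this

theorem integral_sq_sub (hZ : IsSubordinator Z Q) (hκ : 0 < kappaHat Z Q) (t : ℝ≥0) :
    ∫ ω, (Z t ω - t * deriv (kappa Z Q) 0) ^ 2 ∂Q = t * iteratedDeriv 2 (kappa Z Q) 0 := by
  have h := iteratedDeriv_two_cgf_eq_integral (hZ.mem_interior_of_lt_kappaHat (θ := 0) hκ t)
  have hev := hZ.cgf_eventuallyEq (θ := 0) hκ t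
  rw [hev.iteratedDeriv_eq, hev.deriv_eq, deriv_const_mul_field, iteratedDeriv_const_mul_field] at h
  simpa using h.symm

/-- Covariance of the subordinator at two times. -/
theorem integral_sub_mul (hZ : IsSubordinator Z Q) (hκ : 0 < kappaHat Z Q) {s t : ℝ≥0}
    (hst : s ≤ t) :
    ∫ ω, (Z s ω - s * deriv (kappa Z Q) 0) * (Z t ω - t * deriv (kappa Z Q) 0) ∂Q =
      s * iteratedDeriv 2 (kappa Z Q) 0 := by
  set c := deriv (kappa Z Q) 0
  have hindep := hZ.indep_increments.indepFun_eval_sub zero_le hst hZ.zero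
  have hs := hZ.integrable hκ s
  have ht := hZ.integrable hκ t
  have hs' : Integrable (fun ω => Z s ω - s * c) Q := hs.sub (integrable_const _)
  have hd' : Integrable (fun ω => Z t ω - Z s ω - (t - s) * c) Q :=
    (ht.sub hs).sub (integrable_const _)
  have hindep' : IndepFun (fun ω => Z s ω - s * c) (fun ω => Z t ω - Z s ω - (t - s) * c) Q :=
    hindep.comp (φ := fun x => x - s * c) (ψ := fun x => x - (t - s) * c)
      (by fun_prop) (by fun_prop)
  have hsq : Integrable (fun ω => (Z s ω - s * c) ^ 2) Q :=
    ((hZ.memLp hκ s 2).sub (memLp_const _)).integrable_sq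
  have hprod : Integrable (fun ω => (Z s ω - s * c) * (Z t ω - Z s ω - (t - s) * c)) Q :=
    hindep'.integrable_mul hs' hd'
  have hmul := hindep'.integral_fun_mul_eq_mul_integral hs'.aestronglyMeasurable
    hd'.aestronglyMeasurable
  have hzero : ∫ ω, (Z s ω - s * c) ∂Q = 0 := by
    rw [integral_sub hs (integrable_const _), hZ.integral_eq hκ]
    simp [c]
  rw [hzero, zero_mul] at hmul
  -- Splitting `Z t` into `Z s` and an independent increment leaves the variance at `s` plus a mixed
  -- term, which vanishes by centring.
  rw [← hZ.integral_sq_sub hκ s, ← add_zero (∫ ω, (Z s ω - s * c) ^ 2 ∂Q), ← hmul,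
    ← integral_add hsq hprod]
  congr with ω
  ring

/-- Mean of the subordinator under the exponentially tilted measure at a later time. -/
theorem integral_exp_mul (hZ : IsSubordinator Z Q) {ρ : ℝ} (hρ : (ρ : EReal) < kappaHat Z Q)
    {s t : ℝ≥0} (hst : s ≤ t) :
    ∫ ω, Real.exp (ρ * Z t ω - t * kappa Z Q ρ) * Z s ω ∂Q = s * deriv (kappa Z Q) ρ := by
  have hmem := interior_subset (hZ.mem_interior_of_lt_kappaHat hρ 1)
  obtain ⟨h, rfl⟩ := exists_add_of_le hst
  -- The exponential factors at time `s`; the increment contributes `exp(h κ(ρ))`, which the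
  -- normalisation cancels.
  have hindep := (hZ.indepFun_add s h).comp (φ := fun x => x * Real.exp (ρ * x))
    (ψ := fun x => Real.exp (ρ * x)) (by fun_prop) (by fun_prop)
  have hm1 : AEStronglyMeasurable (fun ω => Z s ω * Real.exp (ρ * Z s ω)) Q :=
    ((hZ.aemeasurable s).mul ((hZ.aemeasurable s).const_mul ρ).exp).aestronglyMeasurable
  have hm2 : AEStronglyMeasurable (fun ω => Real.exp (ρ * (Z (s + h) - Z s) ω)) Q :=
    ((((hZ.aemeasurable (s + h)).sub (hZ.aemeasurable s)).const_mul ρ).exp).aestronglyMeasurable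
  have hmul := hindep.integral_fun_mul_eq_mul_integral hm1 hm2
  have e2 : ∫ ω, Real.exp (ρ * (Z (s + h) - Z s) ω) ∂Q = Real.exp (h * kappa Z Q ρ) := by
    rw [← hZ.mgf_eq hmem, ← hZ.mgf_sub s h]; rfl
  simp only [Function.comp_def] at hmul
  rw [hZ.integral_mul_exp hρ, e2] at hmul
  have : ∀ ω, Real.exp (ρ * Z (s + h) ω - (s + h : ℝ≥0) * kappa Z Q ρ) * Z s ω =
      Real.exp (-((s + h : ℝ≥0) * kappa Z Q ρ)) * (Z s ω * Real.exp (ρ * Z s ω) *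
        Real.exp (ρ * (Z (s + h) - Z s) ω)) := by
    intro ω
    rw [show ρ * Z (s + h) ω - (s + h : ℝ≥0) * kappa Z Q ρ = -((s + h : ℝ≥0) * kappa Z Q ρ) +
      ρ * Z s ω + ρ * (Z (s + h) - Z s) ω by simp; ring, Real.exp_add, Real.exp_add]
    ring
  simp_rw [this]
  rw [integral_const_mul, hmul]
  have hexp : Real.exp (-((s + h : ℝ≥0) * kappa Z Q ρ)) * (Real.exp (s * kappa Z Q ρ) *
      Real.exp (h * kappa Z Q ρ)) = 1 := by
    rw [← Real.exp_add, ← Real.exp_add]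
    simp [add_mul]
  linear_combination (s * deriv (kappa Z Q) ρ) * hexp

theorem integrable_exp_mul (hZ : IsSubordinator Z Q) {ρ : ℝ} (hρ : (ρ : EReal) < kappaHat Z Q)
    (t : ℝ≥0) (c : ℝ) : Integrable (fun ω => Real.exp (ρ * Z t ω - c) * Z t ω) Q := by
  have := (integrable_pow_mul_exp_of_mem_interior_integrableExpSet
    (hZ.mem_interior_of_lt_kappaHat hρ t) 1).const_mul (Real.exp (-c))
  refine this.congr (Filter.Eventually.of_forall fun ω => ?_)
  simp only [pow_one]
  rw [sub_eq_add_neg, Real.exp_add]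
  ring

end IsSubordinator

/-! ### Deterministic integrals against the exponential kernel -/

theorem hasDerivAt_exp_neg_mul_sub (lam T u : ℝ) :
    HasDerivAt (fun u => Real.exp (-lam * (T - u))) (lam * Real.exp (-lam * (T - u))) u :=
  ((((hasDerivAt_id' u).const_sub T).const_mul (-lam)).exp).congr_deriv (by ring)

theorem integral_exp_neg_mul_sub {lam : ℝ} (hlam : lam ≠ 0) (a b T : ℝ) :
    ∫ u in a..b, Real.exp (-lam * (T - u)) =
      1 / lam * (Real.exp (-lam * (T - b)) - Real.exp (-lam * (T - a))) := by
  rw [intervalIntegral.integral_eq_sub_of_hasDerivAt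
    (f := fun u => 1 / lam * Real.exp (-lam * (T - u))) (fun u _ => ?_)
    (Continuous.intervalIntegrable (by fun_prop) _ _)]
  · ring
  · exact ((hasDerivAt_exp_neg_mul_sub lam T u).const_mul (1 / lam)).congr_deriv (by field_simp)

theorem integral_exp_neg_mul_sub_mul_id {lam : ℝ} (hlam : lam ≠ 0) (a b T : ℝ) :
    ∫ u in a..b, Real.exp (-lam * (T - u)) * u =
      (b / lam - 1 / lam ^ 2) * Real.exp (-lam * (T - b)) -
        (a / lam - 1 / lam ^ 2) * Real.exp (-lam * (T - a)) := by
  rw [intervalIntegral.integral_eq_sub_of_hasDerivAt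
    (f := fun u => (u / lam - 1 / lam ^ 2) * Real.exp (-lam * (T - u))) (fun u _ => ?_)
    (Continuous.intervalIntegrable (by fun_prop) _ _)]
  refine ((((hasDerivAt_id' u).div_const lam).sub_const (1 / lam ^ 2)).mul
    (hasDerivAt_exp_neg_mul_sub lam T u)).congr_deriv ?_
  field_simp
  ring

/-- The kernel `min s u` is, up to a constant, the covariance of `Z_{λs}` and `Z_{λu}`. -/
theorem integral_exp_neg_mul_sub_mul_min {lam s T : ℝ} (hlam : lam ≠ 0) (hs : s ∈ Icc 0 T) :
    ∫ u in (0 : ℝ)..T, Real.exp (-lam * (T - u)) * min s u =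
      s / lam + (Real.exp (-lam * T) - Real.exp (-lam * (T - s))) / lam ^ 2 := by
  have hint : ∀ a b, IntervalIntegrable (fun u => Real.exp (-lam * (T - u)) * min s u) volume a b :=
    fun a b => Continuous.intervalIntegrable (by fun_prop) _ _
  have h1 : ∫ u in (0 : ℝ)..s, Real.exp (-lam * (T - u)) * min s u =
      ∫ u in (0 : ℝ)..s, Real.exp (-lam * (T - u)) * u := by
    refine intervalIntegral.integral_congr fun u hu => ?_
    rw [uIcc_of_le hs.1] at hu
    simp only [min_eq_right hu.2]
  have h2 : ∫ u in s..T, Real.exp (-lam * (T - u)) * min s u =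
      ∫ u in s..T, Real.exp (-lam * (T - u)) * s := by
    refine intervalIntegral.integral_congr fun u hu => ?_
    rw [uIcc_of_le hs.2] at hu
    simp only [min_eq_left hu.1]
  rw [← intervalIntegral.integral_add_adjacent_intervals (hint 0 s) (hint s T), h1, h2,
    integral_exp_neg_mul_sub_mul_id hlam, intervalIntegral.integral_mul_const,
    integral_exp_neg_mul_sub hlam]
  simp only [sub_self, mul_zero, Real.exp_zero, sub_zero]
  field_simp
  ring

theorem integral_exp_neg_mul_sub_mul_covariance {lam : ℝ} (hlam : lam ≠ 0) (T : ℝ) :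
    ∫ s in (0 : ℝ)..T, Real.exp (-lam * (T - s)) *
        (s / lam + (Real.exp (-lam * T) - Real.exp (-lam * (T - s))) / lam ^ 2) =
      1 / lam ^ 3 * (lam * T - 3 / 2 + 2 * Real.exp (-lam * T) -
        1 / 2 * Real.exp (-2 * lam * T)) := by
  rw [intervalIntegral.integral_eq_sub_of_hasDerivAt
    (f := fun u => (u / lam - 1 / lam ^ 2) / lam * Real.exp (-lam * (T - u)) +
      Real.exp (-lam * T) / lam ^ 3 * Real.exp (-lam * (T - u)) -
      1 / (2 * lam ^ 3) * Real.exp (-lam * (T - u)) ^ 2) (fun u _ => ?_)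
    (Continuous.intervalIntegrable (by fun_prop) _ _)]
  · have : Real.exp (-2 * lam * T) = Real.exp (-lam * T) ^ 2 := by
      rw [← Real.exp_nat_mul]
      congr 1
      push_cast
      ring
    rw [this]
    simp only [sub_self, mul_zero, Real.exp_zero, sub_zero]
    field_simp
    ring
  · have hE := hasDerivAt_exp_neg_mul_sub lam T u
    refine (((((((hasDerivAt_id' u).div_const lam).sub_const (1 / lam ^ 2)).div_const lam).mul
      hE).add (hE.const_mul (Real.exp (-lam * T) / lam ^ 3))).sub
      ((hE.pow 2).const_mul (1 / (2 * lam ^ 3)))).congr_deriv ?_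
    field_simp
    ring

/-- Variation of constants for `dV = -λ V dt + dL` in integrated form, with a right continuous
driving function `L`. -/
theorem integral_eq_of_linear_equation {lam v₀ T : ℝ} (hlam : lam ≠ 0) (hT : 0 ≤ T) {V L : ℝ → ℝ}
    (hV : IntervalIntegrable V volume 0 T)
    (hL : ∀ t, 0 ≤ t → ContinuousWithinAt L (Ici t) t)
    (h : ∀ t ∈ Icc 0 T, V t = v₀ - lam * (∫ s in (0 : ℝ)..t, V s) + L t) :
    ∫ s in (0 : ℝ)..T, V s =
      alpha lam 0 T * v₀ + ∫ s in (0 : ℝ)..T, Real.exp (-lam * (T - s)) * L s := by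
  set A : ℝ → ℝ := fun t => ∫ s in (0 : ℝ)..t, V s with hA
  have hAcont : ContinuousOn A (Icc 0 T) := by
    have := intervalIntegral.continuousOn_primitive_interval
      (intervalIntegrable_iff_integrableOn_Icc_of_le hT |>.1 hV |>.mono_set
        (by rw [uIcc_of_le hT]))
    rwa [uIcc_of_le hT] at this
  have hAint : IntervalIntegrable A volume 0 T :=
    ContinuousOn.intervalIntegrable (by rwa [uIcc_of_le hT])
  have hLint : IntervalIntegrable L volume 0 T := by
    refine ((hV.add (hAint.const_mul lam)).sub (intervalIntegrable_const (c := v₀))).congr ?_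
    intro t ht
    rw [uIoc_of_le hT] at ht
    have := h t (Ioc_subset_Icc_self ht)
    simp only [hA]
    linarith
  -- `L` may jump, so `V` is only right continuous and its primitive is differentiated from the
  -- right; continuity of the primitive then suffices for the fundamental theorem.
  have hderiv : ∀ t ∈ Ioo 0 T, HasDerivWithinAt (fun t => Real.exp (-lam * (T - t)) * A t)
      (Real.exp (-lam * (T - t)) * v₀ + Real.exp (-lam * (T - t)) * L t) (Ioi t) t := by
    intro t ht
    have hnhds : Icc 0 T ∈ nhds t := Icc_mem_nhds ht.1 ht.2
    have hVcont : ContinuousWithinAt V (Ici t) t := by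
      have hR : ContinuousWithinAt (fun t => v₀ - lam * A t + L t) (Ici t) t :=
        (continuousWithinAt_const.sub (continuousWithinAt_const.mul
          (hAcont.continuousAt hnhds).continuousWithinAt)).add (hL t ht.1.le)
      refine hR.congr_of_eventuallyEq ?_ (h t ⟨ht.1.le, ht.2.le⟩)
      filter_upwards [mem_nhdsWithin_of_mem_nhds hnhds] with u hu using h u hu
    have hAder : HasDerivWithinAt A (V t) (Ici t) t := by
      refine intervalIntegral.integral_hasDerivWithinAt_right
        (hV.mono_set ?_) ?_ (hVcont.mono Ioi_subset_Ici_self)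
      · rw [uIcc_of_le hT, uIcc_of_le ht.1.le]
        exact Icc_subset_Icc_right ht.2.le
      · refine ⟨Icc 0 T, mem_nhdsWithin_of_mem_nhds hnhds, ?_⟩
        exact (intervalIntegrable_iff_integrableOn_Icc_of_le hT |>.1 hV).aestronglyMeasurable
    refine ((hasDerivAt_exp_neg_mul_sub lam T t).hasDerivWithinAt.mul
      (hAder.mono Ioi_subset_Ici_self)).congr_deriv ?_
    rw [h t ⟨ht.1.le, ht.2.le⟩]
    simp only [hA]
    ring
  have hint1 : IntervalIntegrable (fun t => Real.exp (-lam * (T - t)) * v₀) volume 0 T :=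
    Continuous.intervalIntegrable (by fun_prop) _ _
  have hint2 : IntervalIntegrable (fun t => Real.exp (-lam * (T - t)) * L t) volume 0 T :=
    hLint.continuousOn_mul (by fun_prop)
  have key := intervalIntegral.integral_eq_sub_of_hasDeriv_right_of_le hT
    ((by fun_prop : Continuous fun t => Real.exp (-lam * (T - t))).continuousOn.mul hAcont)
    hderiv (hint1.add hint2)
  rw [intervalIntegral.integral_add hint1 hint2, intervalIntegral.integral_mul_const,
    integral_exp_neg_mul_sub hlam] at key
  have hA0 : A 0 = 0 := by simp [hA]
  simp only [Pi.mul_apply, hA0, sub_self, mul_zero, Real.exp_zero, one_mul, sub_zero] at key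
  simp only [alpha, sub_zero]
  exact key.symm

/-! ### Joint measurability and Fubini -/

namespace IsSubordinator

variable {Ω : Type*} [MeasurableSpace Ω] {Q : Measure Ω} {Z : ℝ≥0 → Ω → ℝ}

/-- The time-changed subordinator is jointly measurable, up to null sets. -/
theorem aestronglyMeasurable_timeChanged [SFinite Q] (hZ : IsSubordinator Z Q) (lam : ℝ)
    (ν : Measure ℝ) [SFinite ν] :
    AEStronglyMeasurable (fun p : Ω × ℝ => timeChanged Z lam p.2 p.1) (Q.prod ν) := by
  choose W hW hZW using hZ.aemeasurable
  -- Times are rounded up to the grid of mesh `1/(n+1)`; the `+ 1` after the floor keeps the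
  -- approximation on the right, where the paths are continuous.
  let τ : ℕ → ℕ → ℝ≥0 := fun n k => (k + 1) / (n + 1)
  let κ : ℕ → ℝ → ℕ := fun n s => ⌊((n : ℝ≥0) + 1) * (lam * s).toNNReal⌋₊
  let g : ℕ → Ω × ℝ → ℝ := fun n p => W (τ n (κ n p.2)) p.1
  have hcomp : ∀ (σ : ℕ → ℝ≥0) (k : ℝ → ℕ), Measurable k →
      Measurable fun p : Ω × ℝ => W (σ (k p.2)) p.1 := by
    intro σ k hk
    have h1 : Measurable fun q : Ω × ℕ => W (σ q.2) q.1 :=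
      measurable_from_prod_countable_left fun j => hW (σ j)
    exact h1.comp (measurable_fst.prodMk (hk.comp measurable_snd))
  have hg : ∀ n, Measurable (g n) := by
    intro n
    have h2 : Measurable (κ n) :=
      Nat.measurable_floor.comp ((measurable_real_toNNReal.comp
        (measurable_const_mul lam)).const_mul _)
    exact hcomp (τ n) (κ n) h2
  have hτ : ∀ s, Filter.Tendsto (fun n => τ n (κ n s)) Filter.atTop
      (nhdsWithin (lam * s).toNNReal (Ici (lam * s).toNNReal)) := by
    intro s
    set x := (lam * s).toNNReal
    have hge : ∀ n, x ≤ τ n (κ n s) := fun n => by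
      change x ≤ ((κ n s : ℝ≥0) + 1) / ((n : ℝ≥0) + 1)
      rw [le_div_iff₀ (by positivity), mul_comm]
      exact (Nat.lt_floor_add_one _).le
    refine tendsto_nhdsWithin_iff.2 ⟨?_, Filter.Eventually.of_forall fun n => ?_⟩
    · refine tendsto_of_tendsto_of_tendsto_of_le_of_le tendsto_const_nhds
        (h := fun n : ℕ => x + 1 / ((n : ℝ≥0) + 1)) ?_ (fun n => ?_) (fun n => ?_)
      · have : Filter.Tendsto (fun n : ℕ => 1 / ((n : ℝ≥0) + 1)) Filter.atTop (nhds 0) :=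
          tendsto_one_div_add_atTop_nhds_zero_nat
        simpa using this.const_add x
      · exact hge n
      · have : ((κ n s : ℝ≥0)) ≤ (n + 1) * x := Nat.floor_le zero_le
        refine (div_le_iff₀ (by positivity)).2 ?_
        rw [add_mul, one_div, inv_mul_cancel₀ (by positivity)]
        rw [mul_comm x]
        gcongr
    · exact hge n
  have hae : ∀ᵐ ω ∂Q, ∀ s, Filter.Tendsto (fun n => g n (ω, s)) Filter.atTop
      (nhds (timeChanged Z lam s ω)) := by
    have hmk : ∀ᵐ ω ∂Q, ∀ n k, Z (τ n k) ω = W (τ n k) ω :=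
      ae_all_iff.2 fun n => ae_all_iff.2 fun k => hZW (τ n k)
    filter_upwards [hmk, hZ.right_continuous_paths] with ω h1 h2 s
    exact ((h2 (lam * s).toNNReal).tendsto.comp (hτ s)).congr fun n => h1 n _
  exact (aemeasurable_of_tendsto_metrizable_ae Filter.atTop (fun n => (hg n).aemeasurable)
    ((Measure.quasiMeasurePreserving_fst.ae hae).mono fun p hp => hp p.2)).aestronglyMeasurable

/-- Fubini for exponentially weighted time integrals of the subordinator. -/
theorem integral_mul_weighted [SFinite Q] (hZ : IsSubordinator Z Q) {lam T : ℝ} (hlam : 0 ≤ lam)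
    (hT : 0 ≤ T) {X : Ω → ℝ} (hX : AEStronglyMeasurable X Q)
    (hXZ : Integrable (fun ω => X ω * timeChanged Z lam T ω) Q) :
    Integrable (fun ω => X ω * ∫ s in (0 : ℝ)..T,
      Real.exp (-lam * (T - s)) * timeChanged Z lam s ω) Q ∧
    ∫ ω, X ω * (∫ s in (0 : ℝ)..T, Real.exp (-lam * (T - s)) * timeChanged Z lam s ω) ∂Q =
      ∫ s in (0 : ℝ)..T, Real.exp (-lam * (T - s)) * ∫ ω, X ω * timeChanged Z lam s ω ∂Q := by
  set ν : Measure ℝ := volume.restrict (Ioc 0 T)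
  have hF : Integrable (fun p : Ω × ℝ =>
      X p.1 * (Real.exp (-lam * (T - p.2)) * timeChanged Z lam p.2 p.1)) (Q.prod ν) := by
    -- On `(0, T]` the kernel is at most `1` and `Z` is monotone, so `|X Z_{λT}|` dominates.
    refine (hXZ.norm.comp_fst ν).mono' ?_ ?_
    · refine hX.comp_fst.mul (AEStronglyMeasurable.mul ?_
        (hZ.aestronglyMeasurable_timeChanged lam ν))
      exact (by fun_prop : Measurable fun p : Ω × ℝ =>
        Real.exp (-lam * (T - p.2))).aestronglyMeasurable
    · filter_upwards [Measure.quasiMeasurePreserving_fst.ae (hZ.ae_nonneg.and hZ.monotone_paths),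
        Measure.quasiMeasurePreserving_snd.ae (ae_restrict_mem (μ := volume) measurableSet_Ioc)]
        with p h1 h2
      rw [norm_mul, norm_mul (X p.1)]
      refine mul_le_mul_of_nonneg_left ?_ (norm_nonneg _)
      have hmono : timeChanged Z lam p.2 p.1 ≤ timeChanged Z lam T p.1 :=
        h1.2 (Real.toNNReal_mono (mul_le_mul_of_nonneg_left h2.2 hlam))
      have h0 : 0 ≤ timeChanged Z lam p.2 p.1 := h1.1 _
      have hexp : Real.exp (-lam * (T - p.2)) ≤ 1 :=
        Real.exp_le_one_iff.2 (by nlinarith [h2.2])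
      rw [Real.norm_of_nonneg (mul_nonneg (Real.exp_pos _).le h0),
        Real.norm_of_nonneg (h0.trans hmono)]
      calc _ ≤ 1 * timeChanged Z lam p.2 p.1 := mul_le_mul_of_nonneg_right hexp h0
        _ ≤ _ := by rwa [one_mul]
  have hint := hF.integral_prod_left
  have hswap := integral_integral_swap (f := fun ω s =>
    X ω * (Real.exp (-lam * (T - s)) * timeChanged Z lam s ω)) hF
  simp only [intervalIntegral.integral_of_le hT]
  simp only [integral_const_mul] at hint hswap
  refine ⟨hint, hswap.trans ?_⟩
  refine integral_congr_ae (Filter.Eventually.of_forall fun s => ?_)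
  simp only
  rw [← integral_const_mul]
  congr with ω
  ring

end IsSubordinator

/-! ### Smoothness of the Black-Scholes price and the Taylor sum -/

theorem hasDerivAt_stdNormalCDF (z : ℝ) : HasDerivAt stdNormalCDF (gaussianPDFReal 0 1 z) z := by
  have hcont : Continuous (gaussianPDFReal 0 1) := by
    unfold gaussianPDFReal
    fun_prop
  have hint := integrable_gaussianPDFReal 0 1
  have hΦ : ∀ x, stdNormalCDF x = ∫ u in Iic x, gaussianPDFReal 0 1 u := by
    intro x
    rw [stdNormalCDF, cdf_eq_real, measureReal_def,
      gaussianReal_apply_eq_integral 0 one_ne_zero, ENNReal.toReal_ofReal]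
    exact integral_nonneg fun u => gaussianPDFReal_nonneg 0 1 u
  have h : stdNormalCDF =
      fun x => stdNormalCDF 0 + ∫ u in (0 : ℝ)..x, gaussianPDFReal 0 1 u := by
    ext x
    rw [hΦ, hΦ, ← intervalIntegral.integral_Iic_sub_Iic hint.integrableOn hint.integrableOn]
    ring
  rw [h]
  exact (hcont.integral_hasStrictDerivAt 0 z).hasDerivAt.const_add _

theorem contDiff_stdNormalCDF : ContDiff ℝ 2 stdNormalCDF := by
  have hd : deriv stdNormalCDF = gaussianPDFReal 0 1 :=
    funext fun z => (hasDerivAt_stdNormalCDF z).deriv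
  rw [show (2 : WithTop ℕ∞) = 1 + 1 by norm_num, contDiff_succ_iff_deriv]
  refine ⟨fun z => (hasDerivAt_stdNormalCDF z).differentiableAt, by simp, ?_⟩
  rw [hd]
  unfold gaussianPDFReal
  fun_prop

theorem contDiffAt_bsPut {r K T x y : ℝ} (hx : x ≠ 0) (hy : 0 < y) :
    ContDiffAt ℝ 2 (fun p : ℝ × ℝ => bsPut r K T p.1 p.2) (x, y) := by
  by_cases hK : K = 0
  · simp only [bsPut, hK, if_true]
    exact contDiffAt_const
  have h1 : ContDiffAt ℝ 2 (fun p : ℝ × ℝ => 1 / Real.sqrt p.2) (x, y) :=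
    contDiffAt_const.div (contDiffAt_snd.sqrt hy.ne') (Real.sqrt_pos.2 hy).ne'
  have h2 : ContDiffAt ℝ 2 (fun p : ℝ × ℝ => Real.log (p.1 / K) + r * T) (x, y) :=
    ((contDiffAt_fst.div_const K).log (div_ne_zero hx hK)).add contDiffAt_const
  have h3 : ContDiffAt ℝ 2 (fun p : ℝ × ℝ => 1 / 2 * p.2) (x, y) :=
    contDiffAt_const.mul contDiffAt_snd
  simp only [bsPut, hK, if_false, dPlus, dMinus]
  exact (contDiffAt_const.mul
      (contDiff_stdNormalCDF.contDiffAt.comp (x, y) (h1.mul (h2.sub h3)).neg)).sub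
    (contDiffAt_fst.mul (contDiff_stdNormalCDF.contDiffAt.comp (x, y) (h1.mul (h2.add h3)).neg))

theorem putApprox_two {Ω : Type*} [MeasurableSpace Ω] (Q : Measure Ω) (r K T S₀ : ℝ)
    (P I : Ω → ℝ) :
    putApprox Q r K T S₀ P I 2 =
      bsPut r K T S₀ (∫ ω, I ω ∂Q)
      + 1 / 2 * partialDeriv 2 0 (bsPut r K T) S₀ (∫ ω, I ω ∂Q) *
          S₀ ^ 2 * ∫ ω, (P ω - 1) ^ 2 ∂Q
      + 1 / 2 * partialDeriv 0 2 (bsPut r K T) S₀ (∫ ω, I ω ∂Q) *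
          ∫ ω, (I ω - ∫ ω', I ω' ∂Q) ^ 2 ∂Q
      + partialDeriv 1 1 (bsPut r K T) S₀ (∫ ω, I ω ∂Q) *
          S₀ * ∫ ω, (P ω - 1) * (I ω - ∫ ω', I ω' ∂Q) ∂Q := by
  simp only [putApprox, Finset.Icc_self, Finset.sum_singleton, Finset.sum_range_succ,
    Finset.range_zero, Finset.sum_empty]
  simp only [Nat.factorial, Nat.choose, pow_zero, mul_one, one_mul, pow_one, Nat.sub_zero,
    Nat.sub_self, Nat.reduceSub, zero_add, Nat.cast_one, Nat.reduceAdd,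
    Nat.cast_ofNat]
  ring

/-- The integrated variance as a weighted time integral of the driving subordinator. -/
theorem integratedVariance_ae_eq {Ω : Type*} [MeasurableSpace Ω] {Q : Measure Ω} {lam v₀ T : ℝ}
    (hlam : 0 < lam) (hT : 0 ≤ T) {Z : ℝ≥0 → Ω → ℝ} (hZ : IsSubordinator Z Q)
    {V : ℝ → Ω → ℝ} (hV : IsVariance V Z Q lam v₀ T) :
    ∀ᵐ ω ∂Q, integratedVariance V T ω = alpha lam 0 T * v₀ +
      ∫ s in (0 : ℝ)..T, Real.exp (-lam * (T - s)) * timeChanged Z lam s ω := by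
  filter_upwards [hV, hZ.zero, hZ.right_continuous_paths] with ω h h0 hrc
  refine integral_eq_of_linear_equation (V := fun s => V s ω)
    (L := fun s => timeChanged Z lam s ω) hlam.ne' hT h.1 (fun t ht => ?_) (fun t ht => ?_)
  · refine (hrc (lam * t).toNNReal).comp (f := fun s : ℝ => (lam * s).toNNReal)
      (Continuous.continuousWithinAt (by fun_prop)) fun s hs => ?_
    exact Real.toNNReal_mono (mul_le_mul_of_nonneg_left hs hlam.le)
  · rw [h.2 t ht, h0, sub_zero]

theorem alpha_pos {lam T : ℝ} (hlam : 0 < lam) (hT : 0 < T) : 0 < alpha lam 0 T :=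
  mul_pos (by positivity) (sub_pos.2 (Real.exp_lt_one_iff.2 (by nlinarith)))

theorem alpha_le {lam T : ℝ} (hlam : 0 < lam) : alpha lam 0 T ≤ T := by
  have := Real.add_one_le_exp (-lam * (T - 0))
  rw [alpha, one_div, inv_mul_le_iff₀ hlam]
  linarith

theorem integral_exp_neg_mul_sub_mul_linear {lam : ℝ} (hlam : lam ≠ 0) (c T : ℝ) :
    ∫ s in (0 : ℝ)..T, Real.exp (-lam * (T - s)) * (lam * s * c) = c * (T - alpha lam 0 T) := by
  have : ∀ s, Real.exp (-lam * (T - s)) * (lam * s * c) =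
      Real.exp (-lam * (T - s)) * s * (lam * c) := fun s => by ring
  simp_rw [this]
  rw [intervalIntegral.integral_mul_const, integral_exp_neg_mul_sub_mul_id hlam, alpha]
  simp only [sub_self, mul_zero, Real.exp_zero, sub_zero]
  field_simp
  ring

/-! ### Moments of the integrated variance -/

section Moments

variable {Ω : Type*} [MeasurableSpace Ω] {Q : Measure Ω} [IsProbabilityMeasure Q]
  {lam v₀ T : ℝ} {Z : ℝ≥0 → Ω → ℝ} {V : ℝ → Ω → ℝ}

theorem integral_integratedVariance (hlam : 0 < lam) (hT : 0 ≤ T) (hZ : IsSubordinator Z Q)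
    (hV : IsVariance V Z Q lam v₀ T) (hκ : 0 < kappaHat Z Q) :
    Integrable (integratedVariance V T) Q ∧
      ∫ ω, integratedVariance V T ω ∂Q =
        alpha lam 0 T * (v₀ - deriv (kappa Z Q) 0) + deriv (kappa Z Q) 0 * T := by
  have hI := integratedVariance_ae_eq hlam hT hZ hV
  obtain ⟨h1, h2⟩ := hZ.integral_mul_weighted hlam.le hT (X := fun _ => 1)
    aestronglyMeasurable_const (by
      simp only [one_mul]
      exact hZ.integrable hκ _)
  simp only [one_mul] at h1 h2
  refine ⟨((integrable_const (alpha lam 0 T * v₀)).add h1).congr (hI.mono fun ω h => h.symm), ?_⟩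
  rw [integral_congr_ae hI, integral_add (integrable_const _) h1, h2]
  have : ∫ s in (0 : ℝ)..T, Real.exp (-lam * (T - s)) * ∫ ω, timeChanged Z lam s ω ∂Q =
      ∫ s in (0 : ℝ)..T, Real.exp (-lam * (T - s)) * (lam * s * deriv (kappa Z Q) 0) := by
    refine intervalIntegral.integral_congr fun s hs => ?_
    rw [uIcc_of_le hT] at hs
    simp only [timeChanged]
    rw [hZ.integral_eq hκ, Real.coe_toNNReal _ (mul_nonneg hlam.le hs.1)]
  rw [this, integral_exp_neg_mul_sub_mul_linear hlam.ne']
  simp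
  ring

/-- Covariance of the integrated variance with a centred random variable. -/
theorem integral_mul_centred_integratedVariance (hlam : 0 < lam) (hT : 0 ≤ T)
    (hZ : IsSubordinator Z Q) (hV : IsVariance V Z Q lam v₀ T) (m : ℝ) {X : Ω → ℝ}
    (hX : Integrable X Q) (hX0 : ∫ ω, X ω ∂Q = 0)
    (hXZ : Integrable (fun ω => X ω * timeChanged Z lam T ω) Q) :
    Integrable (fun ω => X ω * (integratedVariance V T ω - m)) Q ∧
      ∫ ω, X ω * (integratedVariance V T ω - m) ∂Q =
        ∫ s in (0 : ℝ)..T, Real.exp (-lam * (T - s)) * ∫ ω, X ω * timeChanged Z lam s ω ∂Q := by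
  obtain ⟨h1, h2⟩ := hZ.integral_mul_weighted hlam.le hT hX.aestronglyMeasurable hXZ
  -- All deterministic terms are collected into one multiple of `X`, which integrates to zero; hence
  -- `m` may be arbitrary.
  have hI : (fun ω => X ω * (integratedVariance V T ω - m)) =ᵐ[Q] fun ω =>
      X ω * (alpha lam 0 T * v₀ - m) + X ω *
        ∫ s in (0 : ℝ)..T, Real.exp (-lam * (T - s)) * timeChanged Z lam s ω := by
    filter_upwards [integratedVariance_ae_eq hlam hT hZ hV] with ω h
    rw [h]
    ring
  refine ⟨((hX.mul_const _).add h1).congr hI.symm, ?_⟩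
  rw [integral_congr_ae hI, integral_add (hX.mul_const _) h1, h2, integral_mul_const, hX0]
  ring

/-- The covariance lemma is used twice: with the centred `Z_{λs}` it yields the covariance of `I`
with each `Z_{λs}`, and with `I - m` it then yields the variance. Square integrability of `I` is
thus obtained along the way, not presupposed. -/
theorem integral_sq_centred_integratedVariance (hlam : 0 < lam) (hT : 0 ≤ T)
    (hZ : IsSubordinator Z Q) (hV : IsVariance V Z Q lam v₀ T) (hκ : 0 < kappaHat Z Q) {m : ℝ}
    (hm : m = ∫ ω, integratedVariance V T ω ∂Q) :
    Integrable (fun ω => (integratedVariance V T ω - m) ^ 2) Q ∧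
      ∫ ω, (integratedVariance V T ω - m) ^ 2 ∂Q =
        1 / lam ^ 2 * iteratedDeriv 2 (kappa Z Q) 0 *
          (lam * T - 3 / 2 + 2 * Real.exp (-lam * T) - 1 / 2 * Real.exp (-2 * lam * T)) := by
  set c := deriv (kappa Z Q) 0
  set I := integratedVariance V T
  have hI : Integrable I Q := (integral_integratedVariance hlam hT hZ hV hκ).1
  have hIm : Integrable (fun ω => I ω - m) Q := hI.sub (integrable_const m)
  have hIm0 : ∫ ω, (I ω - m) ∂Q = 0 := by
    rw [integral_sub hI (integrable_const m), ← hm]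
    simp
  have hcoe : ∀ s ∈ Icc 0 T, (((lam * s).toNNReal : ℝ≥0) : ℝ) = lam * s := fun s hs =>
    Real.coe_toNNReal _ (mul_nonneg hlam.le hs.1)
  have hL : ∀ s, Integrable (timeChanged Z lam s) Q := fun s => hZ.integrable hκ _
  have hLL : ∀ s u, Integrable (fun ω => timeChanged Z lam s ω * timeChanged Z lam u ω) Q :=
    fun s u =>
      MemLp.integrable_mul (p := 2) (q := 2) (hZ.memLp hκ _ 2) (hZ.memLp hκ _ 2)
  have hX : ∀ s, Integrable (fun ω => timeChanged Z lam s ω - lam * s * c) Q :=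
    fun s => (hL s).sub (integrable_const _)
  have hX0 : ∀ s ∈ Icc 0 T, ∫ ω, (timeChanged Z lam s ω - lam * s * c) ∂Q = 0 := by
    intro s hs
    rw [integral_sub (hL s) (integrable_const _)]
    simp only [timeChanged]
    rw [hZ.integral_eq hκ, hcoe s hs]
    simp [c]
  have hXL : ∀ s u, Integrable
      (fun ω => (timeChanged Z lam s ω - lam * s * c) * timeChanged Z lam u ω) Q := by
    intro s u
    simp only [sub_mul]
    exact (hLL s u).sub ((hL u).const_mul _)
  have hcov := fun s hs =>
    integral_mul_centred_integratedVariance hlam hT hZ hV m (hX s) (hX0 s hs) (hXL s T)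
  have hIL : ∀ s ∈ Icc 0 T, Integrable (fun ω => (I ω - m) * timeChanged Z lam s ω) Q := by
    intro s hs
    refine ((hcov s hs).1.add (hIm.const_mul (lam * s * c))).congr
      (Filter.Eventually.of_forall fun ω => ?_)
    simp only [Pi.add_apply]
    ring
  have hmin : ∀ s ∈ Icc 0 T, ∀ u ∈ Icc 0 T,
      ∫ ω, (timeChanged Z lam s ω - lam * s * c) * timeChanged Z lam u ω ∂Q =
        lam * min s u * iteratedDeriv 2 (kappa Z Q) 0 := by
    intro s hs u hu
    have hsub : ∫ ω, (timeChanged Z lam s ω - lam * s * c) * timeChanged Z lam u ω ∂Q =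
        ∫ ω, (timeChanged Z lam s ω - lam * s * c) *
          (timeChanged Z lam u ω - lam * u * c) ∂Q := by
      simp only [mul_sub (timeChanged Z lam s _ - lam * s * c)]
      rw [integral_sub (hXL s u) ((hX s).mul_const _), integral_mul_const, hX0 s hs]
      ring
    rw [hsub]
    rcases le_total s u with h | h
    · have := hZ.integral_sub_mul hκ (Real.toNNReal_mono (mul_le_mul_of_nonneg_left h hlam.le))
      rw [hcoe s hs, hcoe u hu] at this
      rw [min_eq_left h]
      exact this
    · have := hZ.integral_sub_mul hκ (Real.toNNReal_mono (mul_le_mul_of_nonneg_left h hlam.le))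
      rw [hcoe s hs, hcoe u hu] at this
      rw [min_eq_right h, ← this]
      congr with ω
      exact mul_comm _ _
  have hinner : ∀ s ∈ Icc 0 T, ∫ ω, (I ω - m) * timeChanged Z lam s ω ∂Q =
      (s / lam + (Real.exp (-lam * T) - Real.exp (-lam * (T - s))) / lam ^ 2) *
        (lam * iteratedDeriv 2 (kappa Z Q) 0) := by
    intro s hs
    have h1 : ∫ ω, (I ω - m) * timeChanged Z lam s ω ∂Q =
        ∫ ω, (timeChanged Z lam s ω - lam * s * c) * (I ω - m) ∂Q := by
      have : ∀ ω, (timeChanged Z lam s ω - lam * s * c) * (I ω - m) =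
          (I ω - m) * timeChanged Z lam s ω - lam * s * c * (I ω - m) := fun ω => by ring
      simp_rw [this]
      rw [integral_sub (hIL s hs) (hIm.const_mul _), integral_const_mul, hIm0]
      ring
    rw [h1, (hcov s hs).2, ← integral_exp_neg_mul_sub_mul_min hlam.ne' hs,
      ← intervalIntegral.integral_mul_const]
    refine intervalIntegral.integral_congr fun u hu => ?_
    rw [uIcc_of_le hT] at hu
    simp only [hmin s hs u hu]
    ring
  obtain ⟨h1, h2⟩ := integral_mul_centred_integratedVariance hlam hT hZ hV m hIm hIm0
    (hIL T ⟨hT, le_rfl⟩)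
  simp only [sq]
  refine ⟨h1, h2.trans ?_⟩
  have : ∫ s in (0 : ℝ)..T, Real.exp (-lam * (T - s)) *
        ∫ ω, (I ω - m) * timeChanged Z lam s ω ∂Q =
      ∫ s in (0 : ℝ)..T, Real.exp (-lam * (T - s)) *
        (s / lam + (Real.exp (-lam * T) - Real.exp (-lam * (T - s))) / lam ^ 2) *
        (lam * iteratedDeriv 2 (kappa Z Q) 0) := by
    refine intervalIntegral.integral_congr fun s hs => ?_
    rw [uIcc_of_le hT] at hs
    simp only [hinner s hs]
    ring
  rw [this, intervalIntegral.integral_mul_const,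
    integral_exp_neg_mul_sub_mul_covariance hlam.ne']
  field_simp

/-! ### Moments involving the price factor -/

variable {ρ : ℝ}

theorem integral_priceFactor_pow (hlam : 0 ≤ lam) (hT : 0 ≤ T) (hZ : IsSubordinator Z Q) (n : ℕ)
    (hρ : KappaFinite Z Q (n * ρ)) :
    Integrable (fun ω => priceFactor Z Q lam ρ T ω ^ n) Q ∧
      ∫ ω, priceFactor Z Q lam ρ T ω ^ n ∂Q =
        Real.exp (lam * T * (-n * kappa Z Q ρ + kappa Z Q (n * ρ))) := by
  have hpow : ∀ ω, priceFactor Z Q lam ρ T ω ^ n = Real.exp (-(n * (lam * T * kappa Z Q ρ))) *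
      Real.exp (n * ρ * Z (lam * T).toNNReal ω) := by
    intro ω
    rw [priceFactor, ← Real.exp_nat_mul, ← Real.exp_add, timeChanged]
    ring_nf
  simp_rw [hpow]
  refine ⟨(hZ.mem_integrableExpSet hρ _).const_mul _, ?_⟩
  rw [integral_const_mul]
  have := hZ.mgf_eq hρ (lam * T).toNNReal
  rw [mgf, Real.coe_toNNReal _ (mul_nonneg hlam hT)] at this
  rw [this, ← Real.exp_add]
  ring_nf

theorem integral_sq_priceFactor_sub_one (hlam : 0 ≤ lam) (hT : 0 ≤ T) (hZ : IsSubordinator Z Q)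
    (hρ : KappaFinite Z Q ρ) (h2ρ : KappaFinite Z Q (2 * ρ)) :
    Integrable (fun ω => (priceFactor Z Q lam ρ T ω - 1) ^ 2) Q ∧
      ∫ ω, (priceFactor Z Q lam ρ T ω - 1) ^ 2 ∂Q =
        Real.exp (lam * T * (-2 * kappa Z Q ρ + kappa Z Q (2 * ρ))) - 1 := by
  obtain ⟨h1, e1⟩ := integral_priceFactor_pow hlam hT hZ 1 (by simpa using hρ)
  obtain ⟨h2, e2⟩ := integral_priceFactor_pow hlam hT hZ 2 (by simpa using h2ρ)
  simp only [pow_one] at h1 e1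
  have : ∀ ω, (priceFactor Z Q lam ρ T ω - 1) ^ 2 =
      priceFactor Z Q lam ρ T ω ^ 2 - (2 * priceFactor Z Q lam ρ T ω - 1) := fun ω => by ring
  simp_rw [this]
  have h3 : Integrable (fun ω => 2 * priceFactor Z Q lam ρ T ω - 1) Q :=
    (h1.const_mul 2).sub (integrable_const (1 : ℝ))
  refine ⟨h2.sub h3, ?_⟩
  rw [integral_sub h2 h3, integral_sub (h1.const_mul 2) (integrable_const _), integral_const_mul,
    e1, e2]
  norm_num

/-- `P` has mean one and acts as an exponential tilt, which changes the mean of `Z_{λs}` from `λ s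
κ'(0)` to `λ s κ'(ρ)`; the difference is linear in `s`. -/
theorem integral_priceFactor_sub_one_mul (hlam : 0 < lam) (hT : 0 ≤ T) (hZ : IsSubordinator Z Q)
    (hV : IsVariance V Z Q lam v₀ T) (hκ : 0 < kappaHat Z Q) (hρ : (ρ : EReal) < kappaHat Z Q)
    (m : ℝ) :
    Integrable (fun ω => (priceFactor Z Q lam ρ T ω - 1) * (integratedVariance V T ω - m)) Q ∧
      ∫ ω, (priceFactor Z Q lam ρ T ω - 1) * (integratedVariance V T ω - m) ∂Q =
        (deriv (kappa Z Q) ρ - deriv (kappa Z Q) 0) * (T - alpha lam 0 T) := by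
  have hρ' : KappaFinite Z Q ρ := interior_subset (hZ.mem_interior_of_lt_kappaHat hρ 1)
  obtain ⟨h1, e1⟩ := integral_priceFactor_pow hlam.le hT hZ 1 (by simpa using hρ')
  simp only [pow_one] at h1 e1
  have hX0 : ∫ ω, (priceFactor Z Q lam ρ T ω - 1) ∂Q = 0 := by
    rw [integral_sub h1 (integrable_const _), e1]
    simp
  have hL : ∀ s, Integrable (timeChanged Z lam s) Q := fun s => hZ.integrable hκ _
  have hPT : Integrable (fun ω => priceFactor Z Q lam ρ T ω * timeChanged Z lam T ω) Q :=
    hZ.integrable_exp_mul hρ _ _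
  have hPL : ∀ s ∈ Icc 0 T,
      Integrable (fun ω => priceFactor Z Q lam ρ T ω * timeChanged Z lam s ω) Q := by
    intro s hs
    refine hPT.mono (h1.aestronglyMeasurable.mul (hL s).aestronglyMeasurable) ?_
    have hst : (lam * s).toNNReal ≤ (lam * T).toNNReal :=
      Real.toNNReal_mono (mul_le_mul_of_nonneg_left hs.2 hlam.le)
    filter_upwards [hZ.ae_nonneg, hZ.ae_le hst] with ω h0 hle
    rw [norm_mul, norm_mul]
    refine mul_le_mul_of_nonneg_left ?_ (norm_nonneg _)
    simp only [timeChanged]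
    rwa [Real.norm_of_nonneg (h0 _), Real.norm_of_nonneg (h0 _)]
  have hXL : ∀ s ∈ Icc 0 T, ∫ ω, (priceFactor Z Q lam ρ T ω - 1) * timeChanged Z lam s ω ∂Q =
      lam * s * (deriv (kappa Z Q) ρ - deriv (kappa Z Q) 0) := by
    intro s hs
    have h := hZ.integral_exp_mul hρ
      (Real.toNNReal_mono (mul_le_mul_of_nonneg_left hs.2 hlam.le))
    have h' := hZ.integral_eq hκ (lam * s).toNNReal
    rw [Real.coe_toNNReal _ (mul_nonneg hlam.le hs.1)] at h h'
    rw [Real.coe_toNNReal _ (mul_nonneg hlam.le hT)] at h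
    simp only [sub_mul, one_mul]
    rw [integral_sub (hPL s hs) (hL s), mul_sub]
    exact congrArg₂ _ h h'
  obtain ⟨h2, e2⟩ := integral_mul_centred_integratedVariance hlam hT hZ hV m
    (h1.sub (integrable_const 1)) hX0 (by
      simp only [Pi.sub_apply, sub_mul, one_mul]
      exact hPT.sub (hL T))
  refine ⟨h2, e2.trans ?_⟩
  rw [← integral_exp_neg_mul_sub_mul_linear hlam.ne']
  refine intervalIntegral.integral_congr fun s hs => ?_
  rw [uIcc_of_le hT] at hs
  exact congrArg (Real.exp (-lam * (T - s)) * ·) (hXL s hs)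

end Moments

end BNS

theorem mainTheorem12 {Ω : Type*} [MeasurableSpace Ω] (Q : Measure Ω) [IsProbabilityMeasure Q]
    (r lam ρ T K S₀ v₀ : ℝ) (hlam : 0 < lam) (hT : 0 < T) (hK : 0 ≤ K) (hS₀ : 0 < S₀)
    (hv₀ : 0 < v₀)
    (Z : ℝ≥0 → Ω → ℝ) (hZ : BNS.IsSubordinator Z Q)
    (V : ℝ → Ω → ℝ) (hV : BNS.IsVariance V Z Q lam v₀ T)
    (hκ : 0 < BNS.kappaHat Z Q) (hρ : (ρ : EReal) < BNS.kappaHat Z Q)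
    (κ : ℝ → ℝ) (hκ_def : κ = BNS.kappa Z Q)
    (I P : Ω → ℝ) (hI : I = BNS.integratedVariance V T)
    (hP : P = BNS.priceFactor Z Q lam ρ T)
    (m : ℝ) (hm : m = ∫ ω, I ω ∂Q) :
    -- the objects occurring in the formulas are well defined
    (ContDiffAt ℝ 2 κ 0 ∧ BNS.KappaFinite Z Q ρ ∧ DifferentiableAt ℝ κ ρ ∧
      0 < m ∧
      ContDiffAt ℝ 2 (fun p : ℝ × ℝ => BNS.bsPut r K T p.1 p.2) (S₀, m)) ∧
    -- mean of the integrated variance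
    (Integrable I Q ∧
      m = BNS.alpha lam 0 T * (v₀ - deriv κ 0) + deriv κ 0 * T) ∧
    -- variance of the integrated variance
    (Integrable (fun ω => (I ω - m) ^ 2) Q ∧
      ∫ ω, (I ω - m) ^ 2 ∂Q =
        1 / lam ^ 2 * iteratedDeriv 2 κ 0 *
          (lam * T - 3 / 2 + 2 * Real.exp (-lam * T) - 1 / 2 * Real.exp (-2 * lam * T))) ∧
    -- cross moment
    (Integrable (fun ω => (P ω - 1) * (I ω - m)) Q ∧
      ∫ ω, (P ω - 1) * (I ω - m) ∂Q =
        (deriv κ ρ - deriv κ 0) * (T - BNS.alpha lam 0 T)) ∧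
    -- second moment of `P - 1`, and the second order approximation
    (BNS.KappaFinite Z Q (2 * ρ) →
      (Integrable (fun ω => (P ω - 1) ^ 2) Q ∧
        ∫ ω, (P ω - 1) ^ 2 ∂Q = Real.exp (lam * T * (-2 * κ ρ + κ (2 * ρ))) - 1) ∧
      BNS.putApprox Q r K T S₀ P I 2 =
        BNS.bsPut r K T S₀ m
        + 1 / 2 * BNS.partialDeriv 2 0 (BNS.bsPut r K T) S₀ m *
            S₀ ^ 2 * ∫ ω, (P ω - 1) ^ 2 ∂Q
        + 1 / 2 * BNS.partialDeriv 0 2 (BNS.bsPut r K T) S₀ m *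
            ∫ ω, (I ω - m) ^ 2 ∂Q
        + BNS.partialDeriv 1 1 (BNS.bsPut r K T) S₀ m *
            S₀ * ∫ ω, (P ω - 1) * (I ω - m) ∂Q) := by
  subst hκ_def hI hP
  have h0 := hZ.analyticAt_kappa (θ := 0) hκ
  have hρ' : BNS.KappaFinite Z Q ρ := interior_subset (hZ.mem_interior_of_lt_kappaHat hρ 1)
  obtain ⟨hIint, hIeq⟩ := BNS.integral_integratedVariance hlam hT.le hZ hV hκ
  rw [← hm] at hIeq
  have hκ1 : 0 ≤ deriv (BNS.kappa Z Q) 0 := by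
    have h1 := hZ.integral_eq hκ 1
    rw [NNReal.coe_one, one_mul] at h1
    rw [← h1]
    exact integral_nonneg_of_ae (hZ.ae_nonneg.mono fun ω h => h 1)
  -- Regrouped, `m = α v₀ + κ'(0) (T - α)`, with first term positive and second nonnegative.
  have hmpos : 0 < m := by
    have h1 := mul_pos (BNS.alpha_pos hlam hT) hv₀
    have h2 := mul_nonneg hκ1 (sub_nonneg.2 (BNS.alpha_le (T := T) hlam))
    rw [hIeq]
    linarith
  refine ⟨⟨h0.contDiffAt, hρ', (hZ.analyticAt_kappa hρ).differentiableAt, hmpos,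
    BNS.contDiffAt_bsPut hS₀.ne' hmpos⟩, ⟨hIint, hIeq⟩,
    BNS.integral_sq_centred_integratedVariance hlam hT.le hZ hV hκ hm,
    BNS.integral_priceFactor_sub_one_mul hlam hT.le hZ hV hκ hρ m, fun h2ρ =>
    ⟨BNS.integral_sq_priceFactor_sub_one hlam.le hT.le hZ hρ' h2ρ, ?_⟩⟩
  rw [hm]
  exact BNS.putApprox_two Q r K T S₀ _ _
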